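/- **TSO model.** There are $n$ processes, a finite set $\mathsf{Var}$ of variables, a main memory $\mathsf m:\mathsf{Var}\to\mathsf{Val}$ and, for each process $i$, a FIFO store buffer of pairs $(x,v)$. A write by $i$ appends a pair to $i$'s buffer; a read of $x$ by $i$ returns the latest value for $x$ in $i$'s buffer, or $\mathsf m(x)$ if there is none; a fence $\mathtt F$ of $i$ is enabled only when $i$'s buffer is empty; $\mathtt{RMW}(x,v_{\rm exp},v_{\rm new})$ is enabled only when $i$'s buffer is empty and $\mathsf m(x)=v_{\rm exp}$, and it sets $\mathsf m(x)$ to $v_{\rm new}$; a local dispatcher $d_i$ may at any time move the oldest pair of $i$'s nonempty buffer to memory ($\mathtt{prop}$). There are also internal actions, and actions $\mathtt{return}$ that end an operation. Local states are the complete local histories of actions, returned values and invocations. A run is an infinite sequence of global states that starts with empty buffers and local states; each round performs a joint action of processes, dispatchers and environment whose actions are enabled and pairwise non-conflicting (no two memory accesses to one variable, unless both are reads from memory). **Register implementations.** A register implementation $\mathcal I$ consists of an initial memory and a nondeterministic protocol, which assigns to every process and local state a nonempty set of allowed (possibly null) actions. The register has values in an infinite set $V$ and a default value $v_0\in V$.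 In a run of $\mathcal I$ every non-null action is allowed by the protocol, the environment invokes $\mathsf{Read}$ and $\mathsf{Write}(v)$ operations ($v\in V$) only at processes that have no pending operation, and each value is written by at most one $\mathsf{Write}$ operation. $\mathcal I$ is *linearizable* if the history of operations of every finite prefix of every run is linearizable with respect to the sequential register with default value $v_0$. $\mathcal I$ is *obstruction-free* if a pending operation of a process $i$ completes whenever from some time on no process other than $i$ takes steps (while $i$ and all dispatchers are scheduled fairly). **Statement.** Let $n\ge 2$ and let $\mathcal I$ be an obstruction-free linearizable implementation of a register in TSO for $n$ processes. Then for every $m>0$ there is a run $r_m$ of $\mathcal I$ in which exactly $m$ $\mathsf{Write}$ operations are invoked, all of them complete, and each of them performs a fence $\mathtt F$ or an $\mathtt{RMW}$ between its invocation and its response. Moreover, $r_m$ can be chosen fair: every nonempty buffer is eventually propagated from, and every process that from some time on always has an enabled non-null action allowed by its protocol eventually moves. -/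

import Mathlib

namespace TSO

/-- Operations of a multi-writer multi-reader register with values in `V`. -/
inductive RegOp (V : Type*) where
  | read : RegOp V
  | write (v : V) : RegOp V

/-- Responses of a register: a write is acknowledged, a read returns a value. -/
inductive RegResp (V : Type*) where
  | ack : RegResp V
  | val (v : V) : RegResp V

/-- The non-null actions of a process: read, write, fence, read-modify-write,
the response `return`, and further internal actions drawn from a type `A`.
The null action is represented by `none : Option (Act Var Val V A)`. -/
inductive Act (Var Val V A : Type*) where
  | read (x : Var) : Act Var Val V A
  | write (x : Var) (v : Val) : Act Var Val V A
  | fence : Act Var Val V A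
  | rmw (x : Var) (vexp vnew : Val) : Act Var Val V A
  | ret (resp : RegResp V) : Act Var Val V A
  | internal (a : A) : Act Var Val V A

/-- The records kept in a local state. A read is recorded with the value it returned, but not with
the place (buffer or memory) the value came from. -/
inductive Rec (Var Val V A : Type*) where
  | read (x : Var) (v : Val) : Rec Var Val V A
  | write (x : Var) (v : Val) : Rec Var Val V A
  | fence : Rec Var Val V A
  | rmw (x : Var) (vexp vnew : Val) : Rec Var Val V A
  | ret (resp : RegResp V) : Rec Var Val V A
  | internal (a : A) : Rec Var Val V A
  | invoke (o : RegOp V) : Rec Var Val V A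

/-- A local state is the list of all records so far, the latest record first. -/
abbrev LocalState (Var Val V A : Type*) := List (Rec Var Val V A)

/-- The operation that has been invoked and not yet returned, if there is one. -/
def pendingOp {Var Val V A : Type*} : LocalState Var Val V A → Option (RegOp V)
  | [] => none
  | Rec.invoke o :: _ => some o
  | Rec.ret _ :: _ => none
  | _ :: l => pendingOp l

/-- A basic TSO state: main memory and one FIFO store buffer per process (oldest entry first). -/
structure MemState (n : ℕ) (Var Val : Type*) where
  mem : Var → Val
  buf : Fin n → List (Var × Val)

/-- A global state: a TSO state and a local state for every process. -/
structure GlobalState (n : ℕ) (Var Val V A : Type*) where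
  tso : MemState n Var Val
  loc : Fin n → LocalState Var Val V A

/-- A joint action: an action (possibly null) of every process, the choice for every local
dispatcher whether it performs `prop` or the null action, and at most one invocation by the
environment at every process. -/
structure JointAct (n : ℕ) (Var Val V A : Type*) where
  proc : Fin n → Option (Act Var Val V A)
  disp : Fin n → Bool
  env : Fin n → Option (RegOp V)

/-- Agents: `Sum.inl i` is the process `i`, and `Sum.inr i` is its local dispatcher `d_i`. -/
abbrev Agent (n : ℕ) := Fin n ⊕ Fin n

section Model

variable {n : ℕ} {Var Val V A : Type*} [DecidableEq Var]

/-- The restriction of the store buffer of `i` to the entries for the variable `x`. -/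
def MemState.bufAt (σ : MemState n Var Val) (i : Fin n) (x : Var) : List (Var × Val) :=
  (σ.buf i).filter (fun p => decide (p.1 = x))

/-- The value returned by a read of `x` by `i`: the latest entry for `x` in the buffer of `i`
(read from buffer), and the value in memory if there is no such entry (read from memory). -/
def MemState.readVal (σ : MemState n Var Val) (i : Fin n) (x : Var) : Val :=
  match (σ.bufAt i x).getLast? with
  | some p => p.2
  | none => σ.mem x

/-- Enabledness of an action of a process. Fences and RMWs require an empty buffer, an RMW
moreover requires that memory holds the expected value; everything else is always enabled. -/
def MemState.Enabled (σ : MemState n Var Val) (i : Fin n) : Act Var Val V A → Prop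
  | Act.fence => σ.buf i = []
  | Act.rmw x vexp _ => σ.buf i = [] ∧ σ.mem x = vexp
  | _ => True

/-- The effect of one action of process `i` on the TSO state. -/
def MemState.procStep (σ : MemState n Var Val) (i : Fin n) :
    Option (Act Var Val V A) → MemState n Var Val
  | some (Act.write x v) => { σ with buf := Function.update σ.buf i (σ.buf i ++ [(x, v)]) }
  | some (Act.rmw x _ vnew) => { σ with mem := Function.update σ.mem x vnew }
  | _ => σ

/-- The effect of a `prop` action of the dispatcher of `i` on the TSO state: the oldest entry of
the buffer is moved to memory. -/
def MemState.propStep (σ : MemState n Var Val) (i : Fin n) : MemState n Var Val :=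
  match σ.buf i with
  | [] => σ
  | (x, v) :: β => { mem := Function.update σ.mem x v, buf := Function.update σ.buf i β }

/-- The effect of a joint action on the TSO state: the actions of the processes `1, …, n` and then
those of the dispatchers `d_1, …, d_n` are performed one by one. -/
def MemState.next (σ : MemState n Var Val) (a : JointAct n Var Val V A) : MemState n Var Val :=
  (List.finRange n).foldl (fun τ i => if a.disp i then τ.propStep i else τ)
    ((List.finRange n).foldl (fun τ i => τ.procStep i (a.proc i)) σ)

/-- The record of an action of process `i` performed in the TSO state `σ`. -/
def MemState.record (σ : MemState n Var Val) (i : Fin n) : Act Var Val V A → Rec Var Val V A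
  | Act.read x => Rec.read x (σ.readVal i x)
  | Act.write x v => Rec.write x v
  | Act.fence => Rec.fence
  | Act.rmw x vexp vnew => Rec.rmw x vexp vnew
  | Act.ret resp => Rec.ret resp
  | Act.internal a => Rec.internal a

/-- The global state that results from a joint action. In every local state the record of the
action of the process comes before that of an invocation in the same round. -/
def GlobalState.next (g : GlobalState n Var Val V A) (a : JointAct n Var Val V A) :
    GlobalState n Var Val V A where
  tso := g.tso.next a
  loc := fun i =>
    ((a.env i).map Rec.invoke).toList ++ ((a.proc i).map (g.tso.record i)).toList ++ g.loc i

/-- In the joint action `a` performed at `σ`, the agent reads `x` from memory. -/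
def ReadsFromMem (σ : MemState n Var Val) (a : JointAct n Var Val V A) (x : Var) :
    Agent n → Prop
  | Sum.inl i => a.proc i = some (Act.read x) ∧ σ.bufAt i x = []
  | Sum.inr _ => False

/-- In the joint action `a` performed at `σ`, the agent performs a memory access of `x`:
an RMW on `x`, a `prop` of an entry for `x`, or a read of `x` from memory. -/
def Accesses (σ : MemState n Var Val) (a : JointAct n Var Val V A) (x : Var) : Agent n → Prop
  | Sum.inl i => (∃ vexp vnew, a.proc i = some (Act.rmw x vexp vnew)) ∨
      ReadsFromMem σ a x (Sum.inl i)
  | Sum.inr i => a.disp i = true ∧ ∃ v β, σ.buf i = (x, v) :: β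

/-- One of the two agents is a dispatcher that performs `prop`, and the other one is the
corresponding process, reading `x` from memory. -/
def OwnPropRead (σ : MemState n Var Val) (a : JointAct n Var Val V A) (x : Var)
    (b c : Agent n) : Prop :=
  ∃ i, a.disp i = true ∧ ReadsFromMem σ a x (Sum.inl i) ∧
    ((b = Sum.inr i ∧ c = Sum.inl i) ∨ (b = Sum.inl i ∧ c = Sum.inr i))

/-- The actions of the agents `b` and `c` in the joint action `a` are conflicting. -/
def Conflict (σ : MemState n Var Val) (a : JointAct n Var Val V A) (b c : Agent n) : Prop :=
  ∃ x, Accesses σ a x b ∧ Accesses σ a x c ∧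
    ¬ (ReadsFromMem σ a x b ∧ ReadsFromMem σ a x c) ∧ ¬ OwnPropRead σ a x b c

/-- The joint action `a` may take place at the TSO state `σ`: each of its actions is enabled at
`σ`, and no two of them are conflicting. -/
structure JointEnabled (σ : MemState n Var Val) (a : JointAct n Var Val V A) : Prop where
  proc_enabled : ∀ i α, a.proc i = some α → σ.Enabled i α
  disp_enabled : ∀ i, a.disp i = true → σ.buf i ≠ []
  nonconflicting : ∀ b c, b ≠ c → ¬ Conflict σ a b c

end Model

/-- A register implementation for `n` processes: a (nondeterministic) protocol, which assigns a
nonempty set of possible actions to every process and local state, and the initial contents of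
memory. -/
structure Implementation (n : ℕ) (Var Val V A : Type*) where
  prot : Fin n → LocalState Var Val V A → Set (Option (Act Var Val V A))
  prot_nonempty : ∀ i l, (prot i l).Nonempty
  initMem : Var → Val

section Runs

variable {n : ℕ} {Var Val V A : Type*} [DecidableEq Var]

/-- A run of an implementation: an infinite sequence of global states, with the joint action `act t`
leading from time `t` to time `t + 1`. The environment invokes an operation only at a
process without a pending operation, and invokes the writing of any given value at most once. -/
structure Run (I : Implementation n Var Val V A) where
  state : ℕ → GlobalState n Var Val V A
  act : ℕ → JointAct n Var Val V A
  init_mem : (state 0).tso.mem = I.initMem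
  init_buf : ∀ i, (state 0).tso.buf i = []
  init_loc : ∀ i, (state 0).loc i = []
  enabled : ∀ t, JointEnabled (state t).tso (act t)
  step : ∀ t, state (t + 1) = (state t).next (act t)
  consistent : ∀ t i α, (act t).proc i = some α → some α ∈ I.prot i ((state t).loc i)
  invoke_idle : ∀ t i o, (act t).env i = some o → pendingOp ((state t).loc i) = none
  write_once : ∀ t i t' i' v, (act t).env i = some (RegOp.write v) →
    (act t').env i' = some (RegOp.write v) → t = t' ∧ i = i'

variable {I : Implementation n Var Val V A}

/-- Operations of a run are named by their process and their starting time. -/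
abbrev OpId (n : ℕ) := Fin n × ℕ

/-- The operation `X` is an invocation of `o`: the environment invokes `o` at process `X.1` in the
round from time `X.2` to time `X.2 + 1`. -/
def Run.Invoked (r : Run I) (X : OpId n) (o : RegOp V) : Prop :=
  (r.act X.2).env X.1 = some o

/-- The operation `X` completes with response `resp` and ending time `e`: its matching `return`
takes place in the round from time `e - 1` to time `e`. -/
def Run.EndsAt (r : Run I) (X : OpId n) (e : ℕ) (resp : RegResp V) : Prop :=
  (∃ o, r.Invoked X o) ∧ ∃ t, e = t + 1 ∧ X.2 < t ∧
    (r.act t).proc X.1 = some (Act.ret resp) ∧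
    ∀ t', X.2 < t' → t' < t → ∀ resp', (r.act t').proc X.1 ≠ some (Act.ret resp')

/-- `X` precedes `Y`: `X` ends before `Y` starts, or both are operations of the same process
and `X` is the earlier one (program order). -/
def Run.Precedes (r : Run I) (X Y : OpId n) : Prop :=
  (∃ e resp, r.EndsAt X e resp ∧ e < Y.2) ∨ (X.1 = Y.1 ∧ X.2 < Y.2)

/-- The sequential specification of a register that currently holds the value `v`. -/
def Legal : V → List (RegOp V × RegResp V) → Prop
  | _, [] => True
  | v, (RegOp.read, RegResp.val w) :: l => w = v ∧ Legal v l
  | _, (RegOp.write w, RegResp.ack) :: l => Legal w l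
  | _, _ :: _ => False

/-- The history of `r` up to time `T` is linearizable with respect to a register with default
value `v₀`. It is well-formed (a process returns only when it has a pending operation), and there is
a legal sequential history that consists of all completed and some of the pending operations,
gives every completed operation the response it has in `r`, and extends the precedence order. -/
def Run.LinearizableUpTo (r : Run I) (v₀ : V) (T : ℕ) : Prop :=
  (∀ t < T, ∀ i resp, (r.act t).proc i = some (Act.ret resp) →
    pendingOp ((r.state t).loc i) ≠ none) ∧
  ∃ L : List (OpId n × RegOp V × RegResp V),
    (L.map Prod.fst).Nodup ∧
    (∀ p ∈ L, p.1.2 < T ∧ r.Invoked p.1 p.2.1) ∧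
    (∀ X e resp, e ≤ T → r.EndsAt X e resp → ∃ o, (X, o, resp) ∈ L) ∧
    L.Pairwise (fun p q => ¬ r.Precedes q.1 p.1) ∧
    Legal v₀ (L.map Prod.snd)

/-- Every finite history of the implementation is linearizable. -/
def Implementation.Linearizable (I : Implementation n Var Val V A) (v₀ : V) : Prop :=
  ∀ (r : Run I) (T : ℕ), r.LinearizableUpTo v₀ T

/-- Every enabled `prop` action is eventually performed. -/
def Run.PropFair (r : Run I) : Prop :=
  ∀ i t, (r.state t).tso.buf i ≠ [] → ∃ t' ≥ t, (r.act t').disp i = true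

/-- If from some time on process `i` always has an enabled non-null action that its
protocol allows, then it eventually moves. -/
def Run.ProcFair (r : Run I) (i : Fin n) : Prop :=
  ∀ t, (∀ t' ≥ t, ∃ α, some α ∈ I.prot i ((r.state t').loc i) ∧ (r.state t').tso.Enabled i α) →
    ∃ t' ≥ t, (r.act t').proc i ≠ none

/-- A run is fair if all dispatchers and all processes are treated fairly. -/
def Run.Fair (r : Run I) : Prop :=
  r.PropFair ∧ ∀ i, r.ProcFair i

/-- An implementation is obstruction-free if a process completes its pending operation
whenever from some time on no other process takes steps (and the process itself
and all dispatchers are treated fairly). -/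
def Implementation.ObstructionFree (I : Implementation n Var Val V A) : Prop :=
  ∀ (r : Run I) (X : OpId n) (o : RegOp V) (T : ℕ), r.Invoked X o →
    (∀ t ≥ T, ∀ j, j ≠ X.1 → (r.act t).proc j = none) →
    r.PropFair → r.ProcFair X.1 → ∃ e resp, r.EndsAt X e resp

/-- `X` is a `Write` operation of the run. -/
def Run.IsWrite (r : Run I) (X : OpId n) : Prop :=
  ∃ v, r.Invoked X (RegOp.write v)

/-- `X` completes, and between its invocation and its response its process performs a
fence or an RMW. -/
def Run.CompletesWithSync (r : Run I) (X : OpId n) : Prop :=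
  ∃ e resp, r.EndsAt X e resp ∧ ∃ t, X.2 < t ∧ t < e ∧
    ((r.act t).proc X.1 = some Act.fence ∨
      ∃ x vexp vnew, (r.act t).proc X.1 = some (Act.rmw x vexp vnew))

end Runs

end TSO

/-!
Suppose that a process `p` executes a write of a fresh value `v` alone, starting from a state with
empty buffers and no pending operations. If it performed neither a fence nor an RMW, then all
propagation could be delayed: `p` still sees its own stores through its buffer, while the memory
stays what it was. A process `q ≠ p` that reads alone afterwards, still without propagation from
`p`, cannot tell this from a state in which the write was never invoked, and so it may return
whatever it could have returned there. Choosing `v` different from that answer contradicts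
linearizability. Hence the write synchronizes. Afterwards the buffer of `p` can be flushed, which
leads back to empty buffers and no pending operations, so the argument can be repeated `m` times,
and a fair schedule completes the run.
-/

namespace TSO

section Steps

/-- A step of an interleaving execution: a joint action in which at most one process, dispatcher
or invocation is active. -/
inductive Step (n : ℕ) (Var Val V A : Type*) where
  | idle : Step n Var Val V A
  | proc (i : Fin n) (α : Act Var Val V A) : Step n Var Val V A
  | prop (i : Fin n) : Step n Var Val V A
  | invoke (i : Fin n) (o : RegOp V) : Step n Var Val V A

variable {n : ℕ} {Var Val V A : Type*}

namespace Step

/-- The joint action in which a single step is performed. -/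
def toJoint : Step n Var Val V A → JointAct n Var Val V A
  | .idle => ⟨fun _ => none, fun _ => false, fun _ => none⟩
  | .proc i α => ⟨fun j => if j = i then some α else none, fun _ => false, fun _ => none⟩
  | .prop i => ⟨fun _ => none, fun j => decide (j = i), fun _ => none⟩
  | .invoke i o => ⟨fun _ => none, fun _ => false, fun j => if j = i then some o else none⟩

/-- The step concerns only process `i` and its dispatcher. -/
def By (i : Fin n) : Step n Var Val V A → Prop
  | .idle => True
  | .proc j _ => j = i
  | .prop j => j = i
  | .invoke j _ => j = i

/-- The step may occur strictly inside an operation that process `i` executes alone: it is by `i`,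
and neither invokes an operation nor returns from one. -/
def Inner (i : Fin n) : Step n Var Val V A → Prop
  | .idle => True
  | .proc j α => j = i ∧ ∀ resp, α ≠ .ret resp
  | .prop j => j = i
  | .invoke _ _ => False

/-- The step is a fence or an RMW, the actions that require an empty buffer. -/
def IsSync : Step n Var Val V A → Prop
  | .proc _ .fence => True
  | .proc _ (.rmw _ _ _) => True
  | _ => False

/-- The step with propagation suppressed. Applied to all steps of an execution, this keeps the
stores in the buffers. -/
def delay : Step n Var Val V A → Step n Var Val V A
  | .prop _ => .idle
  | s => s

/-- The value that the step invokes the writing of, if there is one. -/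
def written? : Step n Var Val V A → Option V
  | .invoke _ (.write v) => some v
  | _ => none

/-- The step is allowed by the protocol and enabled in the global state `g`. -/
def Ok (I : Implementation n Var Val V A) (g : GlobalState n Var Val V A) :
    Step n Var Val V A → Prop
  | .idle => True
  | .proc i α => some α ∈ I.prot i (g.loc i) ∧ g.tso.Enabled i α
  | .prop i => g.tso.buf i ≠ []
  | .invoke i _ => pendingOp (g.loc i) = none

variable {s : Step n Var Val V A} {i : Fin n}

theorem toJoint_proc_eq_some {α : Act Var Val V A} :
    s.toJoint.proc i = some α ↔ s = .proc i α := by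
  cases s <;> grind [toJoint]

theorem toJoint_disp_eq_true : s.toJoint.disp i = true ↔ s = .prop i := by
  cases s <;> grind [toJoint]

theorem toJoint_env_eq_some {o : RegOp V} : s.toJoint.env i = some o ↔ s = .invoke i o := by
  cases s <;> grind [toJoint]

theorem written?_eq_some {v : V} : s.written? = some v ↔ ∃ i, s = .invoke i (.write v) := by
  rcases s with _ | _ | _ | ⟨_, _ | _⟩ <;> simp [written?]

theorem IsSync.eq_fence_or_rmw (hs : s.IsSync) (hi : s.By i) :
    s = .proc i .fence ∨ ∃ x vexp vnew, s = .proc i (.rmw x vexp vnew) := by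
  rcases s with _ | ⟨_, _ | _⟩ | _ | _ <;> simp_all [IsSync, By]

theorem Inner.by (hs : s.Inner i) : s.By i := by
  cases s <;> simp_all [Inner, By]

theorem By.inner (hs : s.By i) (hret : ∀ resp, s ≠ .proc i (.ret resp))
    (hinv : ∀ o, s ≠ .invoke i o) : s.Inner i := by
  cases s <;> simp_all [Inner, By]

theorem Inner.delay (hs : s.Inner i) : s.delay.Inner i := by
  cases s <;> simp_all [Inner, Step.delay]

theorem Inner.ne_invoke (hs : s.Inner i) (j : Fin n) (o : RegOp V) : s ≠ .invoke j o := by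
  rintro rfl
  exact hs

theorem Inner.ne_ret (hs : s.Inner i) (resp : RegResp V) : s ≠ .proc i (.ret resp) := by
  rintro rfl
  exact hs.2 resp rfl

end Step

end Steps

section Effects

variable {n : ℕ} {Var Val V A : Type*} [DecidableEq Var]

theorem foldl_finRange_ite {σ : Type*} (f : σ → σ) (i : Fin n) (s : σ) :
    (List.finRange n).foldl (fun τ j => if j = i then f τ else τ) s = f s := by
  have h := List.foldl_filter (p := (· = i)) (f := fun τ _ => f τ) (l := List.finRange n)
    (init := s)
  simpa [List.filter_eq, List.count_eq_one_of_mem (List.nodup_finRange n) (List.mem_finRange i)]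
    using h.symm

namespace GlobalState

/-- The global state that results from a single step. -/
def after (g : GlobalState n Var Val V A) (s : Step n Var Val V A) : GlobalState n Var Val V A :=
  g.next s.toJoint

variable (g : GlobalState n Var Val V A) (i : Fin n)

@[simp]
theorem after_idle : g.after .idle = g := by
  simp [after, next, MemState.next, Step.toJoint, MemState.procStep]

@[simp]
theorem after_proc (α : Act Var Val V A) : g.after (.proc i α) =
    ⟨g.tso.procStep i (some α), Function.update g.loc i (g.tso.record i α :: g.loc i)⟩ := by
  have hstep (τ : MemState n Var Val) (j : Fin n) :
      τ.procStep j (if j = i then some α else none) =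
        if j = i then τ.procStep i (some α) else τ := by
    split_ifs with hj
    · rw [hj]
    · rfl
  have hloc : (g.after (.proc i α)).loc =
      Function.update g.loc i (g.tso.record i α :: g.loc i) := by
    funext j
    by_cases hj : j = i
    · subst hj; simp [after, next, Step.toJoint]
    · simp [after, next, Step.toJoint, hj]
  rw [← hloc]
  simp [after, next, MemState.next, Step.toJoint, hstep, foldl_finRange_ite]

@[simp]
theorem after_prop : g.after (.prop i) = ⟨g.tso.propStep i, g.loc⟩ := by
  have hstep (τ : MemState n Var Val) (j : Fin n) :
      (if j = i then τ.propStep j else τ) = if j = i then τ.propStep i else τ := by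
    split_ifs with hj
    · rw [hj]
    · rfl
  simp [after, next, MemState.next, Step.toJoint, MemState.procStep, hstep, foldl_finRange_ite]

@[simp]
theorem after_invoke (o : RegOp V) :
    g.after (.invoke i o) = ⟨g.tso, Function.update g.loc i (.invoke o :: g.loc i)⟩ := by
  have hloc : (g.after (.invoke i o)).loc = Function.update g.loc i (.invoke o :: g.loc i) := by
    funext j
    by_cases hj : j = i
    · subst hj; simp [after, next, Step.toJoint]
    · simp [after, next, Step.toJoint, hj]
  rw [← hloc]
  simp [after, next, MemState.next, Step.toJoint, MemState.procStep]

end GlobalState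

namespace MemState

variable (σ : MemState n Var Val) {i j : Fin n}

theorem readVal_procStep_write (x y : Var) (v : Val) :
    (σ.procStep i (some (.write x v : Act Var Val V A))).readVal i y =
      if y = x then v else σ.readVal i y := by
  by_cases h : y = x
  · subst h
    simp [readVal, bufAt, procStep]
  · simp [readVal, bufAt, procStep, h, Ne.symm h]

theorem readVal_propStep (y : Var) : (σ.propStep i).readVal i y = σ.readVal i y := by
  rcases h : σ.buf i with _ | ⟨⟨x, v⟩, β⟩
  · simp [propStep, h]
  · by_cases hy : y = x
    · subst hy
      simp only [readVal, bufAt, propStep, h, Function.update_self, decide_true,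
        List.filter_cons_of_pos, List.getLast?_cons]
      cases List.getLast? (List.filter (fun p => decide (p.1 = y)) β) <;> simp
    · simp [readVal, bufAt, propStep, h, hy, Ne.symm hy]

theorem procStep_buf_of_ne (hj : j ≠ i) (α : Act Var Val V A) :
    (σ.procStep i (some α)).buf j = σ.buf j := by
  cases α <;> simp [procStep, hj]

theorem procStep_buf_ne_nil (i : Fin n) (α : Act Var Val V A) (h : σ.buf j ≠ []) :
    (σ.procStep i (some α)).buf j ≠ [] := by
  by_cases hj : j = i
  · subst hj
    cases α <;> simp [procStep, h]
  · rwa [procStep_buf_of_ne σ hj]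

theorem propStep_buf_of_ne (hj : j ≠ i) : (σ.propStep i).buf j = σ.buf j := by
  rcases h : σ.buf i with _ | ⟨⟨x, v⟩, β⟩ <;> simp [propStep, h, hj]

theorem propStep_buf_self : (σ.propStep i).buf i = (σ.buf i).tail := by
  rcases h : σ.buf i with _ | ⟨⟨x, v⟩, β⟩ <;> simp [propStep, h]

end MemState

namespace GlobalState

variable (g : GlobalState n Var Val V A) {s : Step n Var Val V A} {i j : Fin n}

theorem after_buf_of_by (hs : s.By i) (hj : j ≠ i) : (g.after s).tso.buf j = g.tso.buf j := by
  cases s <;> simp_all [Step.By, MemState.procStep_buf_of_ne, MemState.propStep_buf_of_ne]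

theorem after_loc_of_by (hs : s.By i) (hj : j ≠ i) : (g.after s).loc j = g.loc j := by
  cases s <;> simp_all [Step.By]

theorem after_buf_ne_nil (h : g.tso.buf i ≠ []) (hs : s ≠ .prop i) :
    (g.after s).tso.buf i ≠ [] := by
  rcases s with _ | ⟨j, α⟩ | j | ⟨j, o⟩
  · simpa
  · simpa using g.tso.procStep_buf_ne_nil j α h
  · have hij : i ≠ j := by rintro rfl; exact hs rfl
    simpa [MemState.propStep_buf_of_ne _ hij]
  · simpa

end GlobalState

theorem Step.Ok.jointEnabled {I : Implementation n Var Val V A} {g : GlobalState n Var Val V A}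
    {s : Step n Var Val V A} (h : s.Ok I g) : JointEnabled g.tso s.toJoint where
  proc_enabled i α hα := by
    rw [toJoint_proc_eq_some] at hα
    subst hα
    exact h.2
  disp_enabled i hi := by
    rw [toJoint_disp_eq_true] at hi
    subst hi
    exact h
  nonconflicting b c hbc := by
    rintro ⟨x, hb, hc, -, -⟩
    have active_of_accesses (d : Agent n) (hd : Accesses g.tso s.toJoint x d) :
        (∃ i α, d = .inl i ∧ s = .proc i α) ∨ ∃ i, d = .inr i ∧ s = .prop i := by
      rcases d with i | i
      · rcases hd with ⟨_, _, hd⟩ | ⟨hd, -⟩ <;>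
          exact .inl ⟨i, _, rfl, toJoint_proc_eq_some.1 hd⟩
      · exact .inr ⟨i, rfl, toJoint_disp_eq_true.1 hd.1⟩
    rcases active_of_accesses b hb with ⟨i, α, rfl, rfl⟩ | ⟨i, rfl, rfl⟩ <;>
      rcases active_of_accesses c hc with ⟨j, β, rfl, hj⟩ | ⟨j, rfl, hj⟩ <;> simp_all

end Effects

section Simulations

variable {n : ℕ} {Var Val V A : Type*} {i : Fin n}

namespace GlobalState

/-- The two global states look the same to process `i` and its dispatcher. -/
def AgreeFor (i : Fin n) (g h : GlobalState n Var Val V A) : Prop :=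
  g.tso.mem = h.tso.mem ∧ g.tso.buf i = h.tso.buf i ∧ g.loc i = h.loc i

theorem AgreeFor.trans {g₁ g₂ g₃ : GlobalState n Var Val V A} (h₁ : g₁.AgreeFor i g₂)
    (h₂ : g₂.AgreeFor i g₃) : g₁.AgreeFor i g₃ :=
  ⟨h₁.1.trans h₂.1, h₁.2.1.trans h₂.2.1, h₁.2.2.trans h₂.2.2⟩

variable {g h : GlobalState n Var Val V A} {s : Step n Var Val V A}
  {I : Implementation n Var Val V A}

theorem AgreeFor.ok (hgh : g.AgreeFor i h) (hs : s.By i) (hok : s.Ok I g) : s.Ok I h := by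
  obtain ⟨hmem, hbuf, hloc⟩ := hgh
  rcases s with _ | ⟨k, α⟩ | k | ⟨k, o⟩ <;> simp only [Step.By] at hs <;> try subst hs
  · trivial
  · refine ⟨hloc ▸ hok.1, ?_⟩
    have henabled := hok.2
    cases α <;> simp_all [MemState.Enabled]
  · simpa only [Step.Ok, hbuf] using hok
  · simpa only [Step.Ok, hloc] using hok

variable [DecidableEq Var]

theorem AgreeFor.after (hgh : g.AgreeFor i h) (hs : s.By i) :
    (g.after s).AgreeFor i (h.after s) := by
  obtain ⟨hmem, hbuf, hloc⟩ := hgh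
  rcases s with _ | ⟨k, α⟩ | k | ⟨k, o⟩ <;> simp only [Step.By] at hs <;> try subst hs
  · simpa using ⟨hmem, hbuf, hloc⟩
  · simp only [after_proc, AgreeFor]
    cases α <;> simp [MemState.procStep, MemState.record, MemState.readVal, MemState.bufAt,
      hmem, hbuf, hloc]
  · simp only [after_prop, AgreeFor, MemState.propStep, hbuf]
    rcases hβ : h.tso.buf k with _ | ⟨⟨x, v⟩, β⟩ <;> simp [hmem, hbuf, hloc, hβ]
  · simp [AgreeFor, hmem, hbuf, hloc]

theorem agreeFor_after_delay (g : GlobalState n Var Val V A) {j : Fin n} (hs : s.By i)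
    (hsync : ¬ s.IsSync) (hj : j ≠ i) : g.AgreeFor j (g.after s.delay) := by
  rcases s with _ | ⟨k, α⟩ | k | ⟨k, o⟩ <;> simp only [Step.By] at hs <;> try subst hs
  · simp [Step.delay, AgreeFor]
  · cases α <;> simp_all [Step.delay, AgreeFor, MemState.procStep, Step.IsSync]
  · simp [Step.delay, AgreeFor]
  · simp [Step.delay, AgreeFor, hj]

/-- The two global states have the same local states, and process `i` would read the same values in
them. Process `i` cannot tell them apart even if some of its stores have reached memory in only one
of them. -/
def ReadsSame (i : Fin n) (g h : GlobalState n Var Val V A) : Prop :=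
  g.loc = h.loc ∧ ∀ x, g.tso.readVal i x = h.tso.readVal i x

theorem ReadsSame.after_delay (hgh : g.ReadsSame i h) (hs : s.By i) (hsync : ¬ s.IsSync) :
    (g.after s).ReadsSame i (h.after s.delay) := by
  obtain ⟨hloc, hread⟩ := hgh
  rcases s with _ | ⟨k, α⟩ | k | ⟨k, o⟩ <;> simp only [Step.By] at hs <;> try subst hs
  · simpa [Step.delay] using ⟨hloc, hread⟩
  · simp only [Step.delay, after_proc, ReadsSame]
    cases α with
    | write x v => simp [MemState.record, MemState.readVal_procStep_write, hloc, hread]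
    | fence | rmw => simp [Step.IsSync] at hsync
    | _ => simp [MemState.procStep, MemState.record, hloc, hread]
  · simp [Step.delay, ReadsSame, MemState.readVal_propStep, hloc, hread]
  · simp [Step.delay, ReadsSame, hloc, hread]

theorem ReadsSame.ok_delay (hgh : g.ReadsSame i h) (hsync : ¬ s.IsSync) (hok : s.Ok I g) :
    s.delay.Ok I h := by
  obtain ⟨hloc, -⟩ := hgh
  rcases s with _ | ⟨k, α⟩ | k | ⟨k, o⟩
  · trivial
  · refine ⟨hloc ▸ hok.1, ?_⟩
    cases α <;> simp_all [MemState.Enabled, Step.IsSync]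
  · trivial
  · simpa only [Step.delay, Step.Ok, hloc] using hok

end GlobalState

end Simulations

section Executions

variable {n : ℕ} {Var Val V A : Type*} [DecidableEq Var]

/-- `I.Exec g w h`: the implementation can perform the steps `w` one after the other, which leads
from the global state `g` to `h`. -/
inductive Implementation.Exec (I : Implementation n Var Val V A) :
    GlobalState n Var Val V A → List (Step n Var Val V A) → GlobalState n Var Val V A → Prop
  | nil (g : GlobalState n Var Val V A) : Exec I g [] g
  | cons {g h : GlobalState n Var Val V A} {s : Step n Var Val V A}
      {w : List (Step n Var Val V A)} (hs : s.Ok I g) (hw : Exec I (g.after s) w h) :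
      Exec I g (s :: w) h

/-- The steps of an operation `o` that process `i` executes alone, performing `u` before it
returns `resp`. -/
def opSteps (i : Fin n) (o : RegOp V) (u : List (Step n Var Val V A)) (resp : RegResp V) :
    List (Step n Var Val V A) :=
  .invoke i o :: (u ++ [.proc i (.ret resp)])

namespace Implementation.Exec

variable {I : Implementation n Var Val V A} {g h k : GlobalState n Var Val V A}
  {u w : List (Step n Var Val V A)} {i j : Fin n}

theorem append (hu : I.Exec g u h) (hw : I.Exec h w k) : I.Exec g (u ++ w) k := by
  induction hu with
  | nil => exact hw
  | cons hs _ ih => exact .cons hs (ih hw)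

theorem exists_of_append (huw : I.Exec g (u ++ w) k) : ∃ h, I.Exec g u h ∧ I.Exec h w k := by
  induction u generalizing g with
  | nil => exact ⟨g, .nil g, huw⟩
  | cons s u ih =>
    cases huw with
    | cons hs hw =>
      obtain ⟨h, hu, hw⟩ := ih hw
      exact ⟨h, .cons hs hu, hw⟩

theorem unique (hw : I.Exec g w h) (hw' : I.Exec g w k) : h = k := by
  induction hw with
  | nil => cases hw'; rfl
  | cons _ _ ih => cases hw' with | cons _ hw' => exact ih hw'

theorem buf_eq_of_by (hw : I.Exec g w h) (hby : ∀ s ∈ w, s.By i) (hj : j ≠ i) :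
    h.tso.buf j = g.tso.buf j := by
  induction hw with
  | nil => rfl
  | cons _ _ ih =>
    rw [List.forall_mem_cons] at hby
    rw [ih hby.2, GlobalState.after_buf_of_by _ hby.1 hj]

theorem loc_eq_of_by (hw : I.Exec g w h) (hby : ∀ s ∈ w, s.By i) (hj : j ≠ i) :
    h.loc j = g.loc j := by
  induction hw with
  | nil => rfl
  | cons _ _ ih =>
    rw [List.forall_mem_cons] at hby
    rw [ih hby.2, GlobalState.after_loc_of_by _ hby.1 hj]

theorem simulate {R : GlobalState n Var Val V A → GlobalState n Var Val V A → Prop}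
    {f : Step n Var Val V A → Step n Var Val V A}
    (hR : ∀ s ∈ w, ∀ a b, R a b → s.Ok I a → (f s).Ok I b ∧ R (a.after s) (b.after (f s)))
    (hw : I.Exec g w h) {g' : GlobalState n Var Val V A} (hg : R g g') :
    ∃ h', I.Exec g' (w.map f) h' ∧ R h h' := by
  induction hw generalizing g' with
  | nil => exact ⟨g', .nil g', hg⟩
  | cons hs _ ih =>
    rw [List.forall_mem_cons] at hR
    obtain ⟨hok, hafter⟩ := hR.1 _ _ hg hs
    obtain ⟨h', hw', hh⟩ := ih hR.2 hafter
    exact ⟨h', .cons hok hw', hh⟩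

theorem of_agreeFor (hw : I.Exec g w h) (hby : ∀ s ∈ w, s.By i) {g' : GlobalState n Var Val V A}
    (hg : g.AgreeFor i g') : ∃ h', I.Exec g' w h' := by
  obtain ⟨h', hw', -⟩ := hw.simulate (R := GlobalState.AgreeFor i) (f := id)
    (fun s hs _ _ hab hok => ⟨hab.ok (hby s hs) hok, hab.after (hby s hs)⟩) hg
  exact ⟨h', by simpa using hw'⟩

/-- Without a fence or an RMW, process `i` can run with its stores kept in its buffer, and no other
process `j` sees a difference to the state in which `i` started. -/
theorem exists_delay (hw : I.Exec g w h) (hby : ∀ s ∈ w, s.By i) (hsync : ∀ s ∈ w, ¬ s.IsSync)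
    (hj : j ≠ i) : ∃ h', I.Exec g (w.map Step.delay) h' ∧ g.AgreeFor j h' := by
  obtain ⟨h', hw', -, hagree⟩ := hw.simulate (f := Step.delay)
    (R := fun a b => a.ReadsSame i b ∧ g.AgreeFor j b)
    (fun s hs a b hab hok => ⟨hab.1.ok_delay (hsync s hs) hok,
      hab.1.after_delay (hby s hs) (hsync s hs),
      hab.2.trans (b.agreeFor_after_delay (hby s hs) (hsync s hs) hj)⟩)
    (g' := g) ⟨⟨rfl, fun _ => rfl⟩, rfl, rfl, rfl⟩
  exact ⟨h', hw', hagree⟩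

theorem exists_delay_append (hw : I.Exec g w h) (hby : ∀ s ∈ w, s.By i)
    (hsync : ∀ s ∈ w, ¬ s.IsSync) (hu : I.Exec g u k) (huby : ∀ s ∈ u, s.By j) (hj : j ≠ i) :
    ∃ k', I.Exec g (w.map Step.delay ++ u) k' := by
  obtain ⟨h', hw', hagree⟩ := hw.exists_delay hby hsync hj
  obtain ⟨k', hu'⟩ := hu.of_agreeFor huby hagree
  exact ⟨k', hw'.append hu'⟩

end Implementation.Exec

theorem exists_exec_flush (I : Implementation n Var Val V A) (g : GlobalState n Var Val V A)
    (i : Fin n) : ∃ h, I.Exec g (List.replicate (g.tso.buf i).length (.prop i)) h ∧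
      h.tso.buf i = [] ∧ h.loc = g.loc := by
  induction hβ : g.tso.buf i generalizing g with
  | nil => exact ⟨g, .nil g, hβ, rfl⟩
  | cons p β ih =>
    obtain ⟨h, hexec, hbuf, hloc⟩ := ih (g.after (.prop i))
      (by simp [MemState.propStep_buf_self, hβ])
    exact ⟨h, .cons (by simp [Step.Ok, hβ]) hexec, hbuf, by simpa using hloc⟩

end Executions

section Words

variable {n : ℕ} {Var Val V A : Type*} {w : List (Step n Var Val V A)}

theorem getElem?_append_length_add {α : Type*} (x y : List α) (k : ℕ) :
    (x ++ y)[x.length + k]? = y[k]? := by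
  rw [List.getElem?_append_right (Nat.le_add_right _ _), Nat.add_sub_cancel_left]

theorem getElem?_append_eq_some {α : Type*} {x y : List α} {t : ℕ} {a : α}
    (h : (x ++ y)[t]? = some a) :
    x[t]? = some a ∨ ∃ k, t = x.length + k ∧ y[k]? = some a := by
  rcases lt_or_ge t x.length with ht | ht
  · exact .inl (by rwa [List.getElem?_append_left ht] at h)
  · obtain ⟨k, rfl⟩ := Nat.exists_eq_add_of_le ht
    exact .inr ⟨k, rfl, by rwa [getElem?_append_length_add] at h⟩

/-- The values whose writing is invoked in an execution, in the order of the invocations. -/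
def writtenValues (w : List (Step n Var Val V A)) : List V :=
  w.filterMap Step.written?

theorem writtenValues_append (w y : List (Step n Var Val V A)) :
    writtenValues (w ++ y) = writtenValues w ++ writtenValues y :=
  List.filterMap_append

theorem writtenValues_concat (w : List (Step n Var Val V A)) (s : Step n Var Val V A) :
    writtenValues (w ++ [s]) = writtenValues w ++ s.written?.toList := by
  rw [writtenValues_append]
  cases h : s.written? <;> simp [writtenValues, h]

theorem writtenValues_eq_nil (hw : ∀ s ∈ w, ∀ i o, s ≠ .invoke i o) : writtenValues w = [] := by
  refine List.filterMap_eq_nil_iff.2 fun s hs => Option.eq_none_iff_forall_ne_some.2 fun v hv => ?_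
  obtain ⟨i, rfl⟩ := Step.written?_eq_some.1 hv
  exact hw _ hs i _ rfl

theorem eq_of_nodup_writtenValues (hw : (writtenValues w).Nodup) {v : V} {t t' : ℕ} {i i' : Fin n}
    (ht : w[t]? = some (.invoke i (.write v))) (ht' : w[t']? = some (.invoke i' (.write v))) :
    t = t' := by
  rw [writtenValues, List.Nodup, List.pairwise_filterMap, List.pairwise_iff_getElem] at hw
  obtain ⟨hlt, hs⟩ := List.getElem?_eq_some_iff.1 ht
  obtain ⟨hlt', hs'⟩ := List.getElem?_eq_some_iff.1 ht'
  rcases lt_trichotomy t t' with h | h | h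
  · exact absurd rfl (hw t t' hlt hlt' h v (by simp [hs, Step.written?]) v
      (by simp [hs', Step.written?]))
  · exact h
  · exact absurd rfl (hw t' t hlt' hlt h v (by simp [hs', Step.written?]) v
      (by simp [hs, Step.written?]))

theorem encard_setOf_invoke_write (w : List (Step n Var Val V A)) :
    {X : OpId n | ∃ v, w[X.2]? = some (.invoke X.1 (.write v))}.encard =
      (writtenValues w).length := by
  induction w using List.reverseRecOn with
  | nil => simp [writtenValues]
  | append_singleton w s ih =>
    rw [writtenValues_concat, List.length_append, Nat.cast_add, ← ih]
    have hmem (X : OpId n) : (∃ v, (w ++ [s])[X.2]? = some (.invoke X.1 (.write v))) ↔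
        (∃ v, w[X.2]? = some (.invoke X.1 (.write v))) ∨
          X.2 = w.length ∧ ∃ v, s = .invoke X.1 (.write v) := by
      rw [List.getElem?_append, List.getElem?_singleton]
      grind
    by_cases hs : ∃ i v, s = .invoke i (.write v)
    · obtain ⟨i, v, rfl⟩ := hs
      have hset : {X : OpId n | ∃ u, (w ++ [.invoke i (.write v)])[X.2]? =
            some (.invoke X.1 (.write u))} =
          insert (i, w.length) {X : OpId n | ∃ u, w[X.2]? = some (.invoke X.1 (.write u))} := by
        ext ⟨j, t⟩
        simp only [Set.mem_ofPred_eq, Set.mem_insert_iff, hmem, Prod.mk.injEq,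
          Step.invoke.injEq, RegOp.write.injEq, exists_and_left, exists_eq', and_true]
        grind
      rw [hset, Set.encard_insert_of_notMem (by simp)]
      simp [Step.written?]
    · have hnone : s.written? = none := Option.eq_none_iff_forall_ne_some.2 fun v hv =>
        let ⟨i, hi⟩ := Step.written?_eq_some.1 hv
        hs ⟨i, v, hi⟩
      push Not at hs
      simp [hmem, hs, hnone]

end Words

section Scheduler

variable {n : ℕ} {Var Val V A : Type*}

open Classical in
/-- The step in which the agent whose turn it is moves if it can, where of the processes only those
in `P` may move. -/
noncomputable def schedStep (I : Implementation n Var Val V A) (P : Set (Fin n))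
    (g : GlobalState n Var Val V A) : Option (Agent n) → Step n Var Val V A
  | some (.inl i) =>
    if h : i ∈ P ∧ ∃ α, (Step.proc i α).Ok I g then .proc i h.2.choose else .idle
  | some (.inr i) => if g.tso.buf i ≠ [] then .prop i else .idle
  | none => .idle

variable {I : Implementation n Var Val V A} {P : Set (Fin n)} {g : GlobalState n Var Val V A}

theorem schedStep_cases (c : Option (Agent n)) : schedStep I P g c = .idle ∨
    (∃ i ∈ P, ∃ α, schedStep I P g c = .proc i α) ∨
      ∃ i, g.tso.buf i ≠ [] ∧ schedStep I P g c = .prop i := by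
  rcases c with _ | i | i <;> simp only [schedStep]
  · exact .inl trivial
  · split_ifs with h
    · exact .inr (.inl ⟨i, h.1, _, rfl⟩)
    · exact .inl rfl
  · split_ifs with h
    · exact .inr (.inr ⟨i, h, rfl⟩)
    · exact .inl rfl

theorem schedStep_ok (c : Option (Agent n)) : (schedStep I P g c).Ok I g := by
  rcases c with _ | i | i <;> simp only [schedStep]
  · trivial
  · split_ifs with h
    · exact h.2.choose_spec
    · trivial
  · split_ifs with h
    · exact h
    · trivial

theorem schedStep_ne_invoke (c : Option (Agent n)) (i : Fin n) (o : RegOp V) :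
    schedStep I P g c ≠ .invoke i o := by
  rcases schedStep_cases (I := I) (P := P) (g := g) c with h | ⟨_, _, _, h⟩ | ⟨_, _, h⟩ <;>
    simp [h]

theorem schedStep_by {i : Fin n} (hg : ∀ j ≠ i, g.tso.buf j = []) (c : Option (Agent n)) :
    (schedStep I {i} g c).By i := by
  rcases schedStep_cases (I := I) (P := {i}) (g := g) c with h | ⟨j, hj, _, h⟩ | ⟨j, hj, h⟩ <;>
    rw [h]
  · trivial
  · exact hj
  · exact not_imp_comm.1 (hg j) hj

/-- A schedule that gives every agent infinitely many turns. -/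
def turn (n t : ℕ) : Option (Agent n) := Encodable.decode t.unpair.1

theorem exists_turn_eq (c : Agent n) (t : ℕ) : ∃ t' ≥ t, turn n t' = some c :=
  ⟨Nat.pair (Encodable.encode c) t, Nat.right_le_pair _ _, by simp [turn]⟩

end Scheduler

section FairContinuation

variable {n : ℕ} {Var Val V A : Type*} [DecidableEq Var]

/-- The initial global state. -/
def Implementation.init (I : Implementation n Var Val V A) : GlobalState n Var Val V A :=
  ⟨⟨I.initMem, fun _ => []⟩, fun _ => []⟩

/-- The states of the run that performs the steps `w` and is then scheduled fairly, among the
processes in `P` and all dispatchers. -/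
noncomputable def fairState (I : Implementation n Var Val V A) (P : Set (Fin n))
    (w : List (Step n Var Val V A)) : ℕ → GlobalState n Var Val V A
  | 0 => I.init
  | t + 1 => (fairState I P w t).after
      (w[t]?.getD (schedStep I P (fairState I P w t) (turn n t)))

/-- The steps of the run whose states are given by `fairState`. -/
noncomputable def fairStep (I : Implementation n Var Val V A) (P : Set (Fin n))
    (w : List (Step n Var Val V A)) (t : ℕ) : Step n Var Val V A :=
  w[t]?.getD (schedStep I P (fairState I P w t) (turn n t))

namespace Implementation.Exec

variable {I : Implementation n Var Val V A} {g h : GlobalState n Var Val V A}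
  {w : List (Step n Var Val V A)}

theorem exists_take (hw : I.Exec g w h) {t : ℕ} (ht : t < w.length) :
    ∃ k, I.Exec g (w.take t) k ∧ w[t].Ok I k := by
  rw [← List.take_append_drop t w, List.drop_eq_getElem_cons ht] at hw
  obtain ⟨k, hk, hw⟩ := hw.exists_of_append
  cases hw with | cons hok _ => exact ⟨k, hk, hok⟩

variable (P : Set (Fin n))

theorem take_fairState (hw : I.Exec I.init w g) {t : ℕ} (ht : t ≤ w.length) :
    I.Exec I.init (w.take t) (fairState I P w t) := by
  induction t with
  | zero => exact .nil _
  | succ t ih =>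
    obtain ⟨k, hk, hok⟩ := hw.exists_take ht
    obtain rfl := (ih (Nat.le_of_succ_le ht)).unique hk
    rw [← List.take_concat_get' w t ht, fairState, List.getElem?_eq_getElem ht, Option.getD_some]
    exact hk.append (.cons hok (.nil _))

theorem fairState_length (hw : I.Exec I.init w g) : fairState I P w w.length = g := by
  have h := hw.take_fairState P le_rfl
  rw [List.take_length] at h
  exact h.unique hw

theorem fairStep_ok (hw : I.Exec I.init w g) (t : ℕ) :
    (fairStep I P w t).Ok I (fairState I P w t) := by
  by_cases ht : t < w.length
  · obtain ⟨k, hk, hok⟩ := hw.exists_take ht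
    obtain rfl := (hw.take_fairState P ht.le).unique hk
    simpa [fairStep, ht] using hok
  · simpa [fairStep, Nat.le_of_not_lt ht] using schedStep_ok _

theorem fairStep_range' (hw : I.Exec I.init w g) (t k : ℕ) : I.Exec (fairState I P w t)
    ((List.range' t k).map (fairStep I P w)) (fairState I P w (t + k)) := by
  induction k generalizing t with
  | zero => exact .nil _
  | succ k ih =>
    rw [List.range'_succ, List.map_cons, ← add_assoc, add_right_comm]
    exact .cons (hw.fairStep_ok P t) (ih (t + 1))

end Implementation.Exec

variable {I : Implementation n Var Val V A} {P : Set (Fin n)} {w : List (Step n Var Val V A)}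

theorem fairStep_of_getElem? {t : ℕ} {s : Step n Var Val V A} (ht : w[t]? = some s) :
    fairStep I P w t = s := by
  simp [fairStep, ht]

theorem fairStep_of_length_le {t : ℕ} (ht : w.length ≤ t) :
    fairStep I P w t = schedStep I P (fairState I P w t) (turn n t) := by
  simp [fairStep, ht]

theorem fairStep_eq_invoke {t : ℕ} {i : Fin n} {o : RegOp V} :
    fairStep I P w t = .invoke i o ↔ w[t]? = some (.invoke i o) := by
  cases ht : w[t]? with
  | none => simp [fairStep, ht, schedStep_ne_invoke]
  | some s => simp [fairStep, ht]

/-- The run that performs the steps `w` and is then scheduled fairly, among the processes in `P`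
and all dispatchers. -/
noncomputable def fairRun {g : GlobalState n Var Val V A} (hw : I.Exec I.init w g)
    (hnodup : (writtenValues w).Nodup) (P : Set (Fin n)) : Run I where
  state := fairState I P w
  act t := (fairStep I P w t).toJoint
  init_mem := rfl
  init_buf _ := rfl
  init_loc _ := rfl
  enabled t := (hw.fairStep_ok P t).jointEnabled
  step _ := rfl
  consistent t i α hα := by
    have hok := hw.fairStep_ok P t
    rw [Step.toJoint_proc_eq_some.1 hα] at hok
    exact hok.1
  invoke_idle t i o ho := by
    have hok := hw.fairStep_ok P t
    rwa [Step.toJoint_env_eq_some.1 ho] at hok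
  write_once t i t' i' v ht ht' := by
    rw [Step.toJoint_env_eq_some, fairStep_eq_invoke] at ht ht'
    obtain rfl := eq_of_nodup_writtenValues hnodup ht ht'
    simp_all

variable {g : GlobalState n Var Val V A} (hw : I.Exec I.init w g)
  (hnodup : (writtenValues w).Nodup)

theorem fairRun_invoked {X : OpId n} {o : RegOp V} :
    (fairRun hw hnodup P).Invoked X o ↔ w[X.2]? = some (.invoke X.1 o) :=
  Step.toJoint_env_eq_some.trans fairStep_eq_invoke

theorem fairRun_propFair (P : Set (Fin n)) : (fairRun hw hnodup P).PropFair := by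
  intro i t hbuf
  by_contra! hnever
  have hne : ∀ t' ≥ t, fairStep I P w t' ≠ .prop i := fun t' ht' h =>
    hnever t' ht' (Step.toJoint_disp_eq_true.2 h)
  have hbuf' : ∀ t' ≥ t, (fairState I P w t').tso.buf i ≠ [] := fun t' ht' => by
    induction t', ht' using Nat.le_induction with
    | base => exact hbuf
    | succ t' ht' ih => exact GlobalState.after_buf_ne_nil _ ih (hne t' ht')
  obtain ⟨t', ht', hturn⟩ := exists_turn_eq (.inr i) (max t w.length)
  apply hne t' (le_of_max_le_left ht')
  rw [fairStep_of_length_le (le_of_max_le_right ht'), hturn]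
  exact if_pos (hbuf' t' (le_of_max_le_left ht'))

theorem fairRun_procFair {i : Fin n} (hi : i ∈ P) : (fairRun hw hnodup P).ProcFair i := by
  intro t hable
  obtain ⟨t', ht', hturn⟩ := exists_turn_eq (.inl i) (max t w.length)
  refine ⟨t', le_of_max_le_left ht', ?_⟩
  have hcan : i ∈ P ∧ ∃ α, (Step.proc i α).Ok I (fairState I P w t') :=
    ⟨hi, hable t' (le_of_max_le_left ht')⟩
  have hmove : fairStep I P w t' = .proc i hcan.2.choose := by
    rw [fairStep_of_length_le (le_of_max_le_right ht'), hturn]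
    exact dif_pos hcan
  exact ne_of_eq_of_ne (Step.toJoint_proc_eq_some.2 hmove) (Option.some_ne_none _)

theorem fairRun_invoked_and_endsAt {X : OpId n} {o : RegOp V} {resp : RegResp V}
    {x u y : List (Step n Var Val V A)} (hwx : w = x ++ opSteps X.1 o u resp ++ y)
    (hx : x.length = X.2) (hu : ∀ s ∈ u, ∀ r, s ≠ .proc X.1 (.ret r)) :
    (fairRun hw hnodup P).Invoked X o ∧
      (fairRun hw hnodup P).EndsAt X (X.2 + u.length + 2) resp := by
  have hget (k : ℕ) : w[X.2 + k]? = (opSteps X.1 o u resp ++ y)[k]? := by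
    rw [hwx, List.append_assoc, ← hx, getElem?_append_length_add]
  have hproc {t : ℕ} {s : Step n Var Val V A} (ht : w[t]? = some s) {α : Act Var Val V A} :
      ((fairRun hw hnodup P).act t).proc X.1 = some α ↔ s = .proc X.1 α :=
    Step.toJoint_proc_eq_some.trans (by rw [fairStep_of_getElem? ht])
  have hinvoked := (fairRun_invoked hw hnodup (P := P)).2 (hget 0)
  refine ⟨hinvoked, ⟨o, hinvoked⟩, X.2 + (u.length + 1), rfl, by omega,
    (hproc (s := .proc X.1 (.ret resp)) ?_).2 rfl, fun t hlt hgt r hr => ?_⟩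
  · rw [hget]
    simp [opSteps]
  · obtain ⟨k, rfl⟩ := Nat.exists_eq_add_of_lt hlt
    have hk : k < u.length := by omega
    refine hu _ (List.getElem_mem hk) r ((hproc ?_).1 hr)
    rw [add_assoc, hget]
    simp [opSteps, List.getElem?_append_left hk]

end FairContinuation

section Solo

variable {n : ℕ} {Var Val V A : Type*} [DecidableEq Var] {I : Implementation n Var Val V A}
  {w : List (Step n Var Val V A)} {g : GlobalState n Var Val V A} {i : Fin n}

theorem fairStep_by (hw : I.Exec I.init w g) (hbuf : ∀ j ≠ i, g.tso.buf j = []) {t : ℕ}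
    (ht : w.length ≤ t) : (fairStep I {i} w t).By i := by
  suffices hempty : ∀ j ≠ i, (fairState I {i} w t).tso.buf j = [] by
    rw [fairStep_of_length_le ht]
    exact schedStep_by hempty _
  induction t, ht using Nat.le_induction with
  | base => rwa [hw.fairState_length]
  | succ t ht ih =>
    intro j hj
    have hby : (fairStep I {i} w t).By i := by
      rw [fairStep_of_length_le ht]
      exact schedStep_by ih _
    exact (GlobalState.after_buf_of_by _ hby hj).trans (ih j hj)

theorem Implementation.ObstructionFree.exists_solo (hof : I.ObstructionFree)
    (hw : I.Exec I.init w g) {o : RegOp V} (hnodup : (writtenValues (w ++ [.invoke i o])).Nodup)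
    (hbuf : ∀ j ≠ i, g.tso.buf j = []) (hpend : pendingOp (g.loc i) = none) :
    ∃ u resp h, I.Exec g (opSteps i o u resp) h ∧ ∀ s ∈ u, s.Inner i := by
  set w' := w ++ [.invoke i o] with hw'_def
  have hlen : w'.length = w.length + 1 := by simp [hw'_def]
  have hinvoke : I.Exec g [.invoke i o] (g.after (.invoke i o)) := .cons hpend (.nil _)
  have hw' : I.Exec I.init w' (g.after (.invoke i o)) := hw.append hinvoke
  have hby {t : ℕ} (ht : w'.length ≤ t) : (fairStep I {i} w' t).By i :=
    fairStep_by hw' (by simpa using hbuf) ht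
  obtain ⟨-, resp, -, t, -, hlt, hret, hfirst⟩ := hof (fairRun hw' hnodup {i}) (i, w.length) o
    w'.length ((fairRun_invoked hw' hnodup).2 (by simp [hw'_def]))
    (fun t ht j hj => Option.eq_none_iff_forall_ne_some.2 fun α hα => hj <| by
      have := hby ht
      rwa [Step.toJoint_proc_eq_some.1 hα] at this)
    (fairRun_propFair hw' hnodup {i}) (fairRun_procFair hw' hnodup rfl)
  obtain ⟨k, rfl⟩ := Nat.exists_eq_add_of_le (show w'.length ≤ t by rw [hlen]; exact hlt)
  have hexec := hw'.fairStep_range' {i} w'.length (k + 1)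
  rw [hw'.fairState_length, List.range'_concat, List.map_append, List.map_singleton, one_mul,
    Step.toJoint_proc_eq_some.1 hret] at hexec
  refine ⟨_, resp, _, .cons hpend hexec, List.forall_mem_map.2 fun t ht => ?_⟩
  obtain ⟨hle, hlt'⟩ := List.mem_range'_1.1 ht
  refine (hby hle).inner (fun r hr => ?_) (fun o' ho' => ?_)
  · exact hfirst t (by simp; omega) hlt' r (Step.toJoint_proc_eq_some.2 hr)
  · rw [fairStep_of_length_le hle] at ho'
    exact schedStep_ne_invoke _ _ _ ho'

end Solo

section Linearizability

theorem Legal.read_after_write {V : Type*} {v₀ v : V} {l₁ l₂ : List (RegOp V × RegResp V)}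
    {r resp : RegResp V} (h : Legal v₀ (l₁ ++ (.write v, r) :: (.read, resp) :: l₂)) :
    resp = .val v := by
  induction l₁ generalizing v₀ with
  | nil =>
    rcases r with _ | r <;> rcases resp with _ | w <;> simp_all [Legal]
  | cons p l₁ ih =>
    rcases p with ⟨_ | w, _ | w'⟩ <;> simp only [List.cons_append, Legal] at h
    exacts [ih h.2, ih h]

variable {n : ℕ} {Var Val V A : Type*} [DecidableEq Var] {I : Implementation n Var Val V A}

/-- If every other operation precedes the write, then in a linearization nothing can come between
the write and the read. -/
theorem Run.LinearizableUpTo.read_eq {r : Run I} {v₀ v : V} {X Y : OpId n} {e e' : ℕ}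
    {resp resp' : RegResp V} (hlin : r.LinearizableUpTo v₀ e') (hX : r.Invoked X (.write v))
    (hXe : r.EndsAt X e resp) (hY : r.Invoked Y .read) (hYe : r.EndsAt Y e' resp')
    (hXY : e < Y.2) (hother : ∀ Z o, r.Invoked Z o → Z ≠ X → Z ≠ Y → r.Precedes Z X) :
    resp' = .val v := by
  obtain ⟨-, L, hnodup, hinvoked, hcompleted, hpairwise, hlegal⟩ := hlin
  have hYe' : Y.2 < e' := by
    obtain ⟨-, t, rfl, ht, -⟩ := hYe
    exact ht.trans t.lt_succ_self
  have mem_of_endsAt {Z : OpId n} {o : RegOp V} {a : ℕ} {rZ : RegResp V} (hZ : r.Invoked Z o)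
      (hZe : r.EndsAt Z a rZ) (ha : a ≤ e') : (Z, o, rZ) ∈ L := by
    obtain ⟨o', ho'⟩ := hcompleted Z a rZ ha hZe
    obtain rfl : o = o' := Option.some_injective _ (hZ.symm.trans (hinvoked _ ho').2)
    exact ho'
  have hXL := mem_of_endsAt hX hXe (hXY.trans hYe').le
  have hYL := mem_of_endsAt hY hYe le_rfl
  obtain ⟨l₁, l₂, rfl⟩ := List.append_of_mem hXL
  obtain ⟨-, hpairwise, hbefore⟩ := List.pairwise_append.1 hpairwise
  have hYX : Y ≠ X := by
    rintro rfl
    cases hX.symm.trans hY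
  have hYl₂ : (Y, .read, resp') ∈ l₂ := by
    rcases List.mem_append.1 hYL with hYl₁ | hYl₂
    · exact absurd (.inl ⟨e, resp, hXe, hXY⟩) (hbefore _ hYl₁ _ List.mem_cons_self)
    · exact List.mem_of_ne_of_mem (fun h => hYX (congrArg Prod.fst h)) hYl₂
  have hl₂ : ∀ z ∈ l₂, z = (Y, .read, resp') := by
    intro z hz
    have hzL : z ∈ l₁ ++ (X, .write v, resp) :: l₂ := by simp [hz]
    refine List.inj_on_of_nodup_map hnodup hzL hYL ?_
    by_contra hzY
    have hzX : z.1 ≠ X := by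
      rintro rfl
      simp only [List.map_append, List.map_cons, List.nodup_append, List.nodup_cons] at hnodup
      exact hnodup.2.1.1 (List.mem_map_of_mem hz)
    exact List.rel_of_pairwise_cons hpairwise hz (hother z.1 z.2.1 (hinvoked z hzL).2 hzX hzY)
  rcases l₂ with _ | ⟨z, l₃⟩
  · simp at hYl₂
  · rw [hl₂ z List.mem_cons_self, List.map_append, List.map_cons, List.map_cons] at hlegal
    exact hlegal.read_after_write

end Linearizability

section SoloOperations

variable {n : ℕ} {Var Val V A : Type*} {w u : List (Step n Var Val V A)} {i j : Fin n}
  {o o' : RegOp V} {resp : RegResp V}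

theorem by_of_mem_opSteps (hu : ∀ s ∈ u, s.Inner i) : ∀ s ∈ opSteps i o u resp, s.By i := by
  intro s hs
  simp only [opSteps, List.mem_cons, List.mem_append, List.not_mem_nil, or_false] at hs
  rcases hs with rfl | hs | rfl
  exacts [rfl, (hu s hs).by, rfl]

theorem writtenValues_opSteps (hu : ∀ s ∈ u, s.Inner i) :
    writtenValues (opSteps i o u resp) =
      (Step.invoke i o : Step n Var Val V A).written?.toList := by
  have hrest : writtenValues (u ++ [.proc i (.ret resp)]) = [] := by
    rw [writtenValues_append, writtenValues_eq_nil fun s hs => (hu s hs).ne_invoke]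
    rfl
  rw [opSteps, ← List.singleton_append, writtenValues_append, hrest, List.append_nil]
  cases o <;> rfl

theorem getElem?_opSteps_eq_invoke (hu : ∀ s ∈ u, s.Inner i) {t : ℕ}
    (ht : (opSteps i o u resp)[t]? = some (.invoke j o')) : t = 0 ∧ j = i := by
  cases t with
  | zero =>
    cases ht
    exact ⟨rfl, rfl⟩
  | succ t =>
    have hmem : _ ∈ u ++ _ := List.mem_of_getElem? ht
    rw [List.mem_append, List.mem_singleton, or_iff_left (by simp)] at hmem
    exact absurd rfl ((hu _ hmem).ne_invoke j o')

theorem map_delay_opSteps :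
    (opSteps i o u resp).map Step.delay = opSteps i o (u.map Step.delay) resp := by
  simp [opSteps, Step.delay]

/-- In `w`, the operation `X` is executed alone, from its invocation to its response, and performs a
fence or an RMW. -/
def PerformsSync (w : List (Step n Var Val V A)) (X : OpId n) : Prop :=
  ∃ x o u resp y, w = x ++ opSteps X.1 o u resp ++ y ∧ x.length = X.2 ∧
    (∀ s ∈ u, s.Inner X.1) ∧ ∃ s ∈ u, s.IsSync

theorem PerformsSync.append {X : OpId n} (hX : PerformsSync w X)
    (z : List (Step n Var Val V A)) : PerformsSync (w ++ z) X := by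
  obtain ⟨x, o, u, resp, y, rfl, h⟩ := hX
  exact ⟨x, o, u, resp, y ++ z, List.append_assoc _ _ _, h⟩

variable [DecidableEq Var] {I : Implementation n Var Val V A} {g h : GlobalState n Var Val V A}

theorem Implementation.Exec.pendingOp_eq_none (hexec : I.Exec g (opSteps i o u resp) h) :
    pendingOp (h.loc i) = none := by
  rw [opSteps, ← List.cons_append] at hexec
  obtain ⟨k, -, hret⟩ := hexec.exists_of_append
  cases hret with | cons _ hret =>
  cases hret
  simp [pendingOp, MemState.record]

theorem PerformsSync.completesWithSync {X : OpId n} (hX : PerformsSync w X)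
    (hw : I.Exec I.init w g) (hnodup : (writtenValues w).Nodup) (P : Set (Fin n)) :
    (fairRun hw hnodup P).CompletesWithSync X := by
  obtain ⟨x, o, u, resp, y, hwx, hx, hu, s, hs, hsync⟩ := hX
  obtain ⟨-, hends⟩ := fairRun_invoked_and_endsAt (P := P) hw hnodup hwx hx
    fun s hs => (hu s hs).ne_ret
  obtain ⟨k, hk, rfl⟩ := List.getElem_of_mem hs
  have hget : w[X.2 + 1 + k]? = some u[k] := by
    rw [hwx, ← hx, List.append_assoc, add_assoc, getElem?_append_length_add]
    simp [opSteps, add_comm 1 k, List.getElem?_append_left hk]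
  refine ⟨_, resp, hends, X.2 + 1 + k, by omega, by omega, ?_⟩
  rcases hsync.eq_fence_or_rmw (hu _ hs).by with hfence | ⟨a, vexp, vnew, hrmw⟩
  · exact .inl (Step.toJoint_proc_eq_some.2 ((fairStep_of_getElem? hget).trans hfence))
  · exact .inr ⟨a, vexp, vnew,
      Step.toJoint_proc_eq_some.2 ((fairStep_of_getElem? hget).trans hrmw)⟩

end SoloOperations

section Synchronization

variable {n : ℕ} {Var Val V A : Type*} [DecidableEq Var] {I : Implementation n Var Val V A}
  {w u u' : List (Step n Var Val V A)} {g h k : GlobalState n Var Val V A} {p q : Fin n} {v₀ v : V}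
  {resp resp' : RegResp V}

theorem Implementation.Linearizable.solo_read_eq (hlin : I.Linearizable v₀)
    (hinvoke : ∀ (t : ℕ) i o, w[t]? = some (.invoke i o) → i = p)
    (hnodup : (writtenValues w ++ [v]).Nodup) (hu : ∀ s ∈ u, s.Inner p) (hu' : ∀ s ∈ u', s.Inner q)
    (hexec : I.Exec I.init
      (w ++ opSteps p (.write v) u resp ++ .idle :: opSteps q .read u' resp') g) :
    resp' = .val v := by
  set w' := w ++ opSteps p (.write v) u resp ++ .idle :: opSteps q .read u' resp' with hw'
  have hnodup' : (writtenValues w').Nodup := by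
    rw [hw', ← List.singleton_append (x := Step.idle)]
    simpa only [writtenValues_append, writtenValues_opSteps hu, writtenValues_opSteps hu',
      writtenValues_eq_nil (w := [Step.idle]) (by simp), Step.written?, Option.toList_some,
      Option.toList_none, List.append_nil] using hnodup
  obtain ⟨hX, hXe⟩ := fairRun_invoked_and_endsAt (P := ∅) (X := (p, w.length)) hexec hnodup' hw'
    rfl fun s hs => (hu s hs).ne_ret
  obtain ⟨hY, hYe⟩ := fairRun_invoked_and_endsAt (P := ∅) (X := (q, w.length + u.length + 3))
    (x := w ++ opSteps p (.write v) u resp ++ [.idle]) (o := .read) (u := u') (resp := resp')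
    (y := []) hexec hnodup' (by simp [hw']) (by simp [opSteps]; omega) fun s hs => (hu' s hs).ne_ret
  refine (hlin (fairRun hexec hnodup' ∅) _).read_eq hX hXe hY hYe (Nat.lt_succ_self _) ?_
  · rintro ⟨i, t⟩ o hZ hZX hZY
    rw [fairRun_invoked] at hZ
    rcases getElem?_append_eq_some hZ with hZ | ⟨k, rfl, hk⟩
    · rcases getElem?_append_eq_some hZ with hw | ⟨k, rfl, hk⟩
      · exact .inr ⟨hinvoke _ _ _ hw, (List.getElem?_eq_some_iff.1 hw).1⟩
      · obtain ⟨rfl, rfl⟩ := getElem?_opSteps_eq_invoke hu hk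
        exact absurd rfl hZX
    · rcases k with _ | k
      · cases hk
      · obtain ⟨rfl, rfl⟩ := getElem?_opSteps_eq_invoke hu' hk
        exact absurd (by simp [opSteps]; omega) hZY

/-- Otherwise the write could be run with its stores kept in the buffer of `p`, where the solo read
by `q` does not see them. -/
theorem Implementation.Linearizable.exists_isSync (hlin : I.Linearizable v₀) (hqp : q ≠ p)
    (hexec : I.Exec I.init w g) (hinvoke : ∀ (t : ℕ) i o, w[t]? = some (.invoke i o) → i = p)
    (hnodup : (writtenValues w ++ [v]).Nodup)
    (hwrite : I.Exec g (opSteps p (.write v) u resp) h) (hu : ∀ s ∈ u, s.Inner p)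
    (hread : I.Exec g (opSteps q .read u' resp') k) (hu' : ∀ s ∈ u', s.Inner q)
    (hresp' : resp' ≠ .val v) : ∃ s ∈ u, s.IsSync := by
  by_contra! hsync
  have hsync' : ∀ s ∈ opSteps p (.write v) u resp, ¬ s.IsSync := by
    intro s hs
    simp only [opSteps, List.mem_cons, List.mem_append, List.not_mem_nil, or_false] at hs
    rcases hs with rfl | hs | rfl
    exacts [id, hsync s hs, id]
  have hread' : I.Exec g (.idle :: opSteps q .read u' resp') k :=
    .cons trivial (by rwa [GlobalState.after_idle])
  have hby : ∀ s ∈ Step.idle :: opSteps q .read u' resp', s.By q :=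
    List.forall_mem_cons.2 ⟨trivial, by_of_mem_opSteps hu'⟩
  obtain ⟨k', hdelayed⟩ := hwrite.exists_delay_append (by_of_mem_opSteps hu) hsync' hread' hby hqp
  have hexec' := hexec.append hdelayed
  rw [map_delay_opSteps, ← List.append_assoc] at hexec'
  exact hresp' <| hlin.solo_read_eq hinvoke hnodup
    (List.forall_mem_map.2 fun s hs => (hu s hs).delay) hu' hexec'

/-- `I` can perform the steps `w`, and thereby reach the quiescent state `g`, and all operations
invoked in `w` are solo operations of `p` that perform a fence or an RMW. -/
structure SyncHistory (I : Implementation n Var Val V A) (p : Fin n)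
    (w : List (Step n Var Val V A)) (g : GlobalState n Var Val V A) : Prop where
  exec : I.Exec I.init w g
  buf_eq_nil : ∀ i, g.tso.buf i = []
  pendingOp_eq_none : ∀ i, pendingOp (g.loc i) = none
  nodup : (writtenValues w).Nodup
  invoke : ∀ (t : ℕ) i o, w[t]? = some (.invoke i o) → i = p ∧ PerformsSync w (i, t)

namespace SyncHistory

theorem nil (I : Implementation n Var Val V A) (p : Fin n) : SyncHistory I p [] I.init where
  exec := .nil _
  buf_eq_nil _ := rfl
  pendingOp_eq_none _ := rfl
  nodup := .nil
  invoke := by simp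

theorem append_opSteps (hw : SyncHistory I p w g) (hnodup : (writtenValues w ++ [v]).Nodup)
    (hexec : I.Exec g (opSteps p (.write v) u resp) h) (hu : ∀ s ∈ u, s.Inner p)
    (hsync : ∃ s ∈ u, s.IsSync) : ∃ w' g', SyncHistory I p w' g' ∧
      writtenValues w' = writtenValues w ++ [v] := by
  obtain ⟨g', hflush, hbuf, hloc⟩ := exists_exec_flush I h p
  set f : List (Step n Var Val V A) := List.replicate (h.tso.buf p).length (.prop p)
  have hf : ∀ s ∈ f, s = .prop p := fun s hs => List.eq_of_mem_replicate hs
  have hvalues : writtenValues (w ++ opSteps p (.write v) u resp ++ f) =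
      writtenValues w ++ [v] := by
    simp [writtenValues_append, writtenValues_opSteps hu, Step.written?,
      writtenValues_eq_nil (w := f) fun s hs _ _ => by simp [hf s hs]]
  refine ⟨_, g', ⟨(hw.exec.append hexec).append hflush, fun i => ?_, fun i => ?_,
    hvalues ▸ hnodup, fun t i o ht => ?_⟩, hvalues⟩
  · by_cases hi : i = p
    · rwa [hi]
    · rw [hflush.buf_eq_of_by (fun s hs => by rw [hf s hs]; rfl) hi,
        hexec.buf_eq_of_by (by_of_mem_opSteps hu) hi, hw.buf_eq_nil]
  · rw [hloc]
    by_cases hi : i = p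
    · rw [hi, hexec.pendingOp_eq_none]
    · rw [hexec.loc_eq_of_by (by_of_mem_opSteps hu) hi, hw.pendingOp_eq_none]
  · rcases getElem?_append_eq_some ht with ht | ⟨k, -, hk⟩
    · rcases getElem?_append_eq_some ht with ht | ⟨k, rfl, hk⟩
      · obtain ⟨rfl, hX⟩ := hw.invoke t i o ht
        exact ⟨rfl, (hX.append _).append f⟩
      · obtain ⟨rfl, rfl⟩ := getElem?_opSteps_eq_invoke hu hk
        exact ⟨rfl, w, _, u, resp, f, rfl, rfl, hu, hsync⟩
    · cases hf _ (List.mem_of_getElem? hk)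

theorem exists_append [Infinite V] (hlin : I.Linearizable v₀) (hof : I.ObstructionFree)
    (hqp : q ≠ p) (hw : SyncHistory I p w g) : ∃ w' g' v, SyncHistory I p w' g' ∧
      writtenValues w' = writtenValues w ++ [v] := by
  obtain ⟨u', resp', k, hread, hu'⟩ := hof.exists_solo (i := q) (o := .read) hw.exec
    (by simpa [writtenValues_concat, Step.written?] using hw.nodup)
    (fun i _ => hw.buf_eq_nil i) (hw.pendingOp_eq_none q)
  obtain ⟨v, hv⟩ := ((writtenValues w).finite_toSet.union
    (Set.Subsingleton.finite (s := {v | resp' = .val v}) (by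
      rintro a rfl b hb
      exact (RegResp.val.inj hb)))).exists_notMem
  simp only [Set.mem_union, Set.mem_ofPred_eq, not_or] at hv
  have hnodup : (writtenValues w ++ [v]).Nodup := by
    simpa [List.nodup_append, hw.nodup] using fun a ha (h : a = v) => hv.1 (h ▸ ha)
  obtain ⟨u, resp, h, hwrite, hu⟩ := hof.exists_solo (i := p) (o := .write v) hw.exec
    (by rwa [writtenValues_concat])
    (fun i _ => hw.buf_eq_nil i) (hw.pendingOp_eq_none p)
  have hsync := hlin.exists_isSync hqp hw.exec (fun t i o ht => (hw.invoke t i o ht).1) hnodup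
    hwrite hu hread hu' hv.2
  obtain ⟨w', g', hw', hvalues⟩ := hw.append_opSteps hnodup hwrite hu hsync
  exact ⟨w', g', v, hw', hvalues⟩

theorem exists_length_writtenValues_eq [Infinite V] (hlin : I.Linearizable v₀)
    (hof : I.ObstructionFree) (hqp : q ≠ p) (m : ℕ) :
    ∃ w g, SyncHistory I p w g ∧ (writtenValues w).length = m := by
  induction m with
  | zero => exact ⟨[], _, nil I p, rfl⟩
  | succ m ih =>
    obtain ⟨w, g, hw, rfl⟩ := ih
    obtain ⟨w', g', v, hw', hvalues⟩ := hw.exists_append hlin hof hqp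
    exact ⟨w', g', hw', by rw [hvalues, List.length_append, List.length_singleton]⟩

end SyncHistory

end Synchronization

end TSO

theorem mainTheorem6_general {n : ℕ} (hn : 2 ≤ n) {Var Val V A : Type*} [DecidableEq Var]
    [Infinite V] (v₀ : V) (I : TSO.Implementation n Var Val V A)
    (hlin : I.Linearizable v₀) (hof : I.ObstructionFree) (m : ℕ) :
    ∃ r : TSO.Run I, r.Fair ∧ {X : TSO.OpId n | r.IsWrite X}.encard = m ∧
      ∀ X : TSO.OpId n, r.IsWrite X → r.CompletesWithSync X := by
  have : Nontrivial (Fin n) := Fin.nontrivial_iff_two_le.2 hn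
  obtain ⟨p, q, hpq⟩ := exists_pair_ne (Fin n)
  obtain ⟨w, g, hw, rfl⟩ := TSO.SyncHistory.exists_length_writtenValues_eq hlin hof hpq.symm m
  refine ⟨TSO.fairRun hw.exec hw.nodup Set.univ,
    ⟨TSO.fairRun_propFair _ _ _, fun i => TSO.fairRun_procFair _ _ (Set.mem_univ i)⟩, ?_, ?_⟩
  · simp only [TSO.Run.IsWrite, TSO.fairRun_invoked]
    exact TSO.encard_setOf_invoke_write w
  · rintro X ⟨v, hX⟩
    rw [TSO.fairRun_invoked] at hX
    exact (hw.invoke _ _ _ hX).2.completesWithSync hw.exec hw.nodup _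

theorem mainTheorem6 {n : ℕ} (hn : 2 ≤ n) {Var Val V A : Type*} [DecidableEq Var] [Finite Var]
    [Infinite V] (v₀ : V) (I : TSO.Implementation n Var Val V A)
    (hlin : I.Linearizable v₀) (hof : I.ObstructionFree) (m : ℕ) (hm : 0 < m) :
    ∃ r : TSO.Run I, r.Fair ∧ {X : TSO.OpId n | r.IsWrite X}.encard = m ∧
      ∀ X : TSO.OpId n, r.IsWrite X → r.CompletesWithSync X :=
  mainTheorem6_general hn v₀ I hlin hof m
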